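/- Let $f_k=\prod_{i\ge 1}(1-q^{ki})$, a formal power series in $q$ with integer coefficients, and let the integers $P^*(n)$, $n\ge 0$, be defined by the generating function $$\sum_{n\ge 0}P^*(n)q^n=f_1^4f_5^4 .$$ Then for all integers $n\ge 0$ and $\alpha\ge 1$, $$P^*\left(2\cdot 5^{\alpha}n+2\cdot 5^{\alpha}-1\right)\equiv 0\pmod{4\cdot 5^{\alpha}}.$$ -/

import Mathlib

namespace RestrictedPartitions

open PowerSeries
open scoped PowerSeries.WithPiTopology

/-- The infinite product `(a; q)_∞ = ∏_{i ≥ 0} (1 - a q ^ i)` of formal power series over `ℤ`.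
The product is taken in the topology of coefficientwise convergence, `ℤ` being discrete. -/
noncomputable def qPochhammerInf (a q : PowerSeries ℤ) : PowerSeries ℤ :=
  ∏' i : ℕ, (1 - a * q ^ i)

/-- `f_k = (q ^ k; q ^ k)_∞`, where `q` is the formal variable. -/
noncomputable def f (k : ℕ) : PowerSeries ℤ :=
  qPochhammerInf (X ^ k) (X ^ k)

/-- For `k ≥ 1` the product defining `f k` converges, so that `f k` is its actual value. -/
theorem multipliable_f {k : ℕ} (hk : 1 ≤ k) :
    Multipliable fun i : ℕ => (1 : PowerSeries ℤ) - X ^ k * (X ^ k) ^ i := by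
  simp only [sub_eq_add_neg]
  apply PowerSeries.WithPiTopology.multipliable_one_add_of_tendsto_order_atTop_nhds_top
  refine ENat.tendsto_nhds_top_iff_natCast_lt.mpr fun n => ?_
  filter_upwards [Filter.eventually_ge_atTop n] with i hi
  have h : (X : PowerSeries ℤ) ^ k * (X ^ k) ^ i = X ^ (k * (i + 1)) := by ring
  rw [order_neg, h, order_X_pow]
  exact_mod_cast (by nlinarith : n < k * (i + 1))

/-- The restricted color partition function `P*`, given by its generating function:
`∑_{n ≥ 0} P*(n) q ^ n = f_1 ^ 4 * f_5 ^ 4`. Its values are integers, possibly negative. -/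
noncomputable def PStar (n : ℕ) : ℤ :=
  coeff n (f 1 ^ 4 * f 5 ^ 4)

end RestrictedPartitions

/-! The moduli 4 and `5 ^ α` are coprime and are treated separately. Modulo 4, the fourth power of
`f 1 * f 5` is a series in `q ^ 2`, so its odd coefficients vanish (`four_dvd_PStar_of_odd`). For 5,
`q * (f 1 * f 5) ^ 4` is an eigenform of the operator keeping exponents divisible by 5, with
eigenvalue `-5` (`PStar_five_mul_add_four`); iteration gives `(-5) ^ α`. The relation comes from
5-dissecting `f 1 ^ 4 = f 1 * f 1 ^ 3`, using Euler's pentagonal series for `f 1` and Jacobi's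
series for `f 1 ^ 3`. Jacobi's identity is obtained by differentiating a finite `q`-binomial theorem
and letting `n` grow. -/

namespace RestrictedPartitions

open PowerSeries
open scoped PowerSeries.WithPiTopology

/-! ### Finite `q`-binomial theorem and finite Jacobi identity -/

section QBinomial

variable {R : Type*} [CommRing R]

/-- The finite product `(q; q)_n = ∏_{i = 1}^{n} (1 - q ^ i)`. -/
def qFactorial (q : R) (n : ℕ) : R :=
  ∏ i ∈ Finset.range n, (1 - q ^ (i + 1))

/-- The Gaussian binomial coefficient `[k + l; k]_q`, indexed symmetrically by `k` and `l`. -/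
def gaussBinom (q : R) : ℕ → ℕ → R
  | 0, _ => 1
  | _ + 1, 0 => 1
  | k + 1, l + 1 => gaussBinom q k (l + 1) + q ^ (k + 1) * gaussBinom q (k + 1) l

@[simp]
theorem gaussBinom_zero_left (q : R) (l : ℕ) : gaussBinom q 0 l = 1 := by
  simp [gaussBinom]

@[simp]
theorem gaussBinom_zero_right (q : R) (k : ℕ) : gaussBinom q k 0 = 1 := by
  cases k <;> simp [gaussBinom]

theorem gaussBinom_succ_succ (q : R) (k l : ℕ) :
    gaussBinom q (k + 1) (l + 1) =
      gaussBinom q k (l + 1) + q ^ (k + 1) * gaussBinom q (k + 1) l := by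
  rw [gaussBinom]

@[simp]
theorem qFactorial_zero (q : R) : qFactorial q 0 = 1 := by
  simp [qFactorial]

theorem qFactorial_succ (q : R) (n : ℕ) :
    qFactorial q (n + 1) = qFactorial q n * (1 - q ^ (n + 1)) :=
  Finset.prod_range_succ _ _

theorem gaussBinom_mul_qFactorial_mul_qFactorial (q : R) (k l : ℕ) :
    gaussBinom q k l * qFactorial q k * qFactorial q l = qFactorial q (k + l) := by
  match k, l with
  | 0, l => simp
  | k + 1, 0 => simp
  | k + 1, l + 1 =>
    have h₁ := gaussBinom_mul_qFactorial_mul_qFactorial q k (l + 1)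
    have h₂ := gaussBinom_mul_qFactorial_mul_qFactorial q (k + 1) l
    rw [show k + (l + 1) = k + l + 1 by ring] at h₁
    rw [show k + 1 + l = k + l + 1 by ring] at h₂
    rw [gaussBinom_succ_succ, show k + 1 + (l + 1) = k + l + 1 + 1 by ring,
      qFactorial_succ q (k + l + 1)]
    rw [qFactorial_succ q l] at h₁ ⊢
    rw [qFactorial_succ q k] at h₂ ⊢
    linear_combination (1 - q ^ (k + 1)) * h₁ + q ^ (k + 1) * (1 - q ^ (l + 1)) * h₂

/-- The finite `q`-binomial theorem of Rothe. -/
theorem prod_add_mul_pow_eq_sum_gaussBinom (q a b : R) (N : ℕ) :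
    ∏ i ∈ Finset.range N, (a + b * q ^ i) =
      ∑ p ∈ Finset.HasAntidiagonal.antidiagonal N,
        gaussBinom q p.1 p.2 * q ^ p.1.choose 2 * b ^ p.1 * a ^ p.2 := by
  induction N generalizing b with
  | zero => simp
  | succ N ih =>
    have h : ∏ i ∈ Finset.range N, (a + b * q ^ (i + 1)) =
        ∏ i ∈ Finset.range N, (a + b * q * q ^ i) :=
      Finset.prod_congr rfl fun i _ => by ring
    rw [Finset.prod_range_succ', h, ih, pow_zero, mul_one, mul_add, Finset.sum_mul,
      Finset.sum_mul]
    cases N with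
    | zero => simp [Finset.Nat.antidiagonal_succ]
    | succ N =>
      rw [Finset.Nat.sum_antidiagonal_succ, Finset.Nat.sum_antidiagonal_succ',
        Finset.Nat.sum_antidiagonal_succ, Finset.Nat.sum_antidiagonal_succ']
      have hchoose (k : ℕ) : (k + 1).choose 2 = k + k.choose 2 := by
        rw [Nat.choose_succ_succ' k 1, Nat.choose_one_right]
      have hterm : ∀ p ∈ Finset.HasAntidiagonal.antidiagonal N,
          gaussBinom q (p.1 + 1) (p.2 + 1) * q ^ (p.1 + 1).choose 2 * b ^ (p.1 + 1) *
              a ^ (p.2 + 1) =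
            gaussBinom q (p.1 + 1) p.2 * q ^ (p.1 + 1).choose 2 * (b * q) ^ (p.1 + 1) *
                a ^ p.2 * a +
              gaussBinom q p.1 (p.2 + 1) * q ^ p.1.choose 2 * (b * q) ^ p.1 *
                a ^ (p.2 + 1) * b := by
        intro p _
        simp only [gaussBinom_succ_succ, hchoose]
        ring
      rw [Finset.sum_congr rfl hterm, Finset.sum_add_distrib]
      simp only [gaussBinom_zero_left, gaussBinom_zero_right, hchoose, Nat.choose_zero_succ]
      ring

theorem map_gaussBinom {S : Type*} [CommRing S] (φ : R →+* S) (q : R) (k l : ℕ) :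
    φ (gaussBinom q k l) = gaussBinom (φ q) k l := by
  match k, l with
  | 0, l => simp
  | k + 1, 0 => simp
  | k + 1, l + 1 =>
    simp [gaussBinom_succ_succ, map_gaussBinom φ q k (l + 1), map_gaussBinom φ q (k + 1) l]

theorem prod_pow_sub_pow (q : R) (n : ℕ) :
    ∏ i ∈ Finset.range n, (q ^ n - q ^ i) = (-1) ^ n * q ^ n.choose 2 * qFactorial q n := by
  induction n with
  | zero => simp
  | succ n ih =>
    have h : ∏ i ∈ Finset.range n, (q ^ (n + 1) - q ^ (i + 1)) =
        q ^ n * ∏ i ∈ Finset.range n, (q ^ n - q ^ i) := by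
      have h' := Finset.pow_card_mul_prod (s := Finset.range n) (f := fun i => q ^ n - q ^ i)
        (b := q)
      rw [Finset.card_range] at h'
      rw [h']
      exact Finset.prod_congr rfl fun i _ => by ring
    rw [Finset.prod_range_succ', h, ih, qFactorial_succ, Nat.choose_succ_succ' n 1,
      Nat.choose_one_right]
    ring

theorem prod_pow_sub_pow_add (q : R) (n : ℕ) :
    ∏ i ∈ Finset.range n, (q ^ n - q ^ (n + 1 + i)) = q ^ (n * n) * qFactorial q n := by
  have h : ∀ i ∈ Finset.range n, q ^ n - q ^ (n + 1 + i) = q ^ n * (1 - q ^ (i + 1)) :=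
    fun i _ => by ring
  rw [Finset.prod_congr rfl h, Finset.prod_mul_distrib, Finset.prod_const, Finset.card_range,
    ← pow_mul, qFactorial]

open Polynomial in
/-- The derivative at `z = 1` of the finite `q`-binomial theorem for `∏ (q ^ n - z q ^ i)`. -/
theorem pow_mul_qFactorial_sq_eq_sum_antidiagonal (q : R) (n : ℕ) :
    -((-1) ^ n * q ^ (n + n.choose 2 + n * n) * qFactorial q n ^ 2) =
      ∑ p ∈ Finset.HasAntidiagonal.antidiagonal (2 * n + 1),
        (-1) ^ p.1 * p.1 * gaussBinom q p.1 p.2 * q ^ (p.1.choose 2 + n * p.2) := by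
  have h := congrArg (fun F : R[X] => (derivative F).eval 1)
    (prod_add_mul_pow_eq_sum_gaussBinom (Polynomial.C q) (Polynomial.C q ^ n) (-Polynomial.X)
      (2 * n + 1))
  have hterm : ∀ p ∈ Finset.HasAntidiagonal.antidiagonal (2 * n + 1),
      gaussBinom (Polynomial.C q) p.1 p.2 * Polynomial.C q ^ p.1.choose 2 *
          (-Polynomial.X) ^ p.1 * (Polynomial.C q ^ n) ^ p.2 =
        Polynomial.C ((-1) ^ p.1 * gaussBinom q p.1 p.2 * q ^ (p.1.choose 2 + n * p.2)) *
          Polynomial.X ^ p.1 := by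
    intro p _
    rw [← map_gaussBinom, neg_pow]
    simp only [map_mul, map_pow, map_neg, map_one]
    ring
  rw [Finset.sum_congr rfl hterm] at h
  -- Isolate the factor `i = n`: it vanishes at `z = 1`, so only the term differentiating it
  -- survives.
  nth_rw 1 [show 2 * n + 1 = n + 1 + n by ring] at h
  rw [Finset.prod_range_add, Finset.prod_range_succ] at h
  simp only [Polynomial.derivative_sum, Polynomial.derivative_C_mul_X_pow,
    Polynomial.eval_finsetSum, Polynomial.eval_C_mul, Polynomial.eval_pow, Polynomial.eval_X,
    one_pow, mul_one] at h
  simp only [Polynomial.derivative_mul, Polynomial.eval_add, Polynomial.eval_mul,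
    Polynomial.eval_prod] at h
  simp [← sub_eq_add_neg, prod_pow_sub_pow, prod_pow_sub_pow_add] at h
  convert h using 1
  · ring
  · exact Finset.sum_congr rfl fun p _ => by ring

/-- The finite form of Jacobi's identity, before cancelling a power of `q`. -/
theorem pow_mul_qFactorial_sq_eq_sum_range (q : R) (n : ℕ) :
    q ^ (n + n.choose 2 + n * n) * qFactorial q n ^ 2 =
      q ^ (n + n.choose 2 + n * n) * ∑ j ∈ Finset.range (n + 1),
        (-1) ^ j * q ^ (j + 1).choose 2 *
          ((j + n + 1) * gaussBinom q (n + 1 + j) (n - j) -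
            (n - j) * gaussBinom q (n - j) (n + 1 + j)) := by
  have h := pow_mul_qFactorial_sq_eq_sum_antidiagonal q n
  -- Pair the indices `n - j` and `n + 1 + j`, which carry the same power of `q` (`e₁`, `e₂`) and
  -- opposite signs (`s₁`, `s₂`).
  rw [Finset.Nat.sum_antidiagonal_eq_sum_range_succ_mk,
    show (2 * n + 1).succ = (n + 1) + (n + 1) by lia, Finset.sum_range_add,
    ← Finset.sum_range_reflect, ← Finset.sum_add_distrib] at h
  rw [Finset.mul_sum]
  have hsq : ((-1 : R) ^ n) * (-1) ^ n = 1 := by rw [← mul_pow]; simp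
  calc _ = -(-1) ^ n * -((-1) ^ n * q ^ (n + n.choose 2 + n * n) * qFactorial q n ^ 2) := by
        linear_combination (-q ^ (n + n.choose 2 + n * n) * qFactorial q n ^ 2) * hsq
    _ = _ := by
      rw [h, Finset.mul_sum]
      refine Finset.sum_congr rfl fun j hj => ?_
      obtain ⟨i, rfl⟩ : ∃ i, n = j + i := ⟨n - j, by grind⟩
      have hchoose (k : ℕ) : 2 * k.choose 2 + k = k * k := by
        rw [Nat.choose_two_right]
        have := Nat.even_mul_pred_self k
        cases k with
        | zero => rfl
        | succ k =>
          rw [Nat.mul_div_cancel' this.two_dvd]; simp; ring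
      rw [show j + i + 1 - 1 - j = i by lia, show j + i - j = i by lia,
        show 2 * (j + i) + 1 - i = j + i + 1 + j by lia,
        show 2 * (j + i) + 1 - (j + i + 1 + j) = i by lia]
      have e₁ : i.choose 2 + (j + i) * (j + i + 1 + j) =
          (j + i) + (j + i).choose 2 + (j + i) * (j + i) + (j + 1).choose 2 := by
        have h₁ := hchoose i
        have h₂ := hchoose (j + i)
        have h₃ := hchoose (j + 1)
        nlinarith
      have e₂ : (j + i + 1 + j).choose 2 + (j + i) * i =
          (j + i) + (j + i).choose 2 + (j + i) * (j + i) + (j + 1).choose 2 := by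
        have h₁ := hchoose (j + i + 1 + j)
        have h₂ := hchoose (j + i)
        have h₃ := hchoose (j + 1)
        nlinarith
      rw [e₁, e₂, pow_add q _ ((j + 1).choose 2)]
      have s₁ : (-1 : R) ^ (j + i) * (-1) ^ i = (-1) ^ j := by
        rw [pow_add, mul_assoc, ← mul_pow]; simp
      have s₂ : (-1 : R) ^ (j + i) * (-1) ^ (j + i + 1 + j) = -(-1) ^ j := by
        rw [show j + i + 1 + j = j + i + (j + 1) by ring, pow_add _ (j + i), ← mul_assoc, hsq]
        ring
      push_cast
      generalize q ^ (j + i + (j + i).choose 2 + (j + i) * (j + i)) = Q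
      generalize q ^ (j + 1).choose 2 = T
      generalize (-1 : R) ^ (j + i) = S at *
      linear_combination (-Q * T * i * gaussBinom q i (j + i + 1 + j)) * s₁ +
        (-Q * T * (j + i + 1 + j) * gaussBinom q (j + i + 1 + j) i) * s₂

end QBinomial

/-! ### Euler's product and Jacobi's identity as power series -/

theorem f_one_eq_pentagonalSeries : f 1 = pentagonalSeries ℤ := by
  rw [← (WithPiTopology.hasProd_one_sub_X_pow ℤ).tprod_eq]
  exact tprod_congr fun i => by rw [pow_one, ← pow_succ']

theorem f_eq_expand {k : ℕ} (hk : k ≠ 0) : f k = expand k hk (f 1) := by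
  have h := WithPiTopology.hasProd_one_sub_X_pow ℤ
  rw [← f_one_eq_pentagonalSeries] at h
  suffices HasProd (fun i : ℕ => (1 : PowerSeries ℤ) - X ^ k * (X ^ k) ^ i)
      (expand k hk (f 1)) from this.tprod_eq
  rw [HasProd, WithPiTopology.tendsto_iff_coeff_tendsto] at h ⊢
  intro d
  have hprod (s : Finset ℕ) : ∏ i ∈ s, ((1 : PowerSeries ℤ) - X ^ k * (X ^ k) ^ i) =
      expand k hk (∏ i ∈ s, (1 - X ^ (i + 1))) := by
    simp [map_prod, pow_succ']
  simp only [hprod, coeff_expand]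
  split_ifs
  · exact h _
  · exact tendsto_const_nhds

theorem qFactorial_X_sub_dvd {m n : ℕ} (h : m ≤ n) :
    (X : PowerSeries ℤ) ^ (m + 1) ∣ qFactorial X n - qFactorial X m := by
  induction n, h using Nat.le_induction with
  | base => simp
  | succ n h ih =>
    rw [qFactorial_succ, show qFactorial (X : PowerSeries ℤ) n * (1 - X ^ (n + 1)) -
      qFactorial X m = (qFactorial X n - qFactorial X m) - qFactorial X n * X ^ (n + 1) by ring]
    exact dvd_sub ih (Dvd.dvd.mul_left (pow_dvd_pow _ (by lia)) _)

/-- Lets the passage to the limit be done by congruences modulo powers of `X`. -/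
theorem f_one_sub_qFactorial_dvd {m n : ℕ} (h : m ≤ n) :
    (X : PowerSeries ℤ) ^ (m + 1) ∣ f 1 - qFactorial X n := by
  rw [X_pow_dvd_iff]
  intro d hd
  have hlim := (WithPiTopology.hasProd_one_sub_X_pow ℤ).tendsto_prod_nat
  rw [← f_one_eq_pentagonalSeries, WithPiTopology.tendsto_iff_coeff_tendsto] at hlim
  rw [map_sub, sub_eq_zero]
  refine tendsto_nhds_unique (hlim d) (tendsto_atTop_of_eventually_const (i₀ := n) fun N hN => ?_)
  have := X_pow_dvd_iff.1 (qFactorial_X_sub_dvd hN) d (by lia)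
  rwa [map_sub, sub_eq_zero] at this

theorem constantCoeff_qFactorial_X (n : ℕ) :
    constantCoeff (qFactorial (X : PowerSeries ℤ) n) = 1 := by
  simp [qFactorial]

theorem qFactorial_X_ne_zero (n : ℕ) : qFactorial (X : PowerSeries ℤ) n ≠ 0 := fun h => by
  simpa [h] using constantCoeff_qFactorial_X n

theorem gaussBinom_X_comm (k l : ℕ) :
    gaussBinom (X : PowerSeries ℤ) k l = gaussBinom X l k := by
  have h₁ := gaussBinom_mul_qFactorial_mul_qFactorial (X : PowerSeries ℤ) k l
  have h₂ := gaussBinom_mul_qFactorial_mul_qFactorial (X : PowerSeries ℤ) l k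
  rw [add_comm l k, ← h₁] at h₂
  refine mul_right_cancel₀ (qFactorial_X_ne_zero k)
    (mul_right_cancel₀ (qFactorial_X_ne_zero l) ?_)
  linear_combination -h₂

theorem isUnit_f_one : IsUnit (f 1) := by
  have h := X_pow_dvd_iff.1 (f_one_sub_qFactorial_dvd (le_refl 0)) 0 one_pos
  rw [map_sub, sub_eq_zero, coeff_zero_eq_constantCoeff, constantCoeff_qFactorial_X] at h
  rw [isUnit_iff_constantCoeff, h]
  exact isUnit_one

/-- Quantitative form of the limit of Gaussian binomials being `1 / f 1`. -/
theorem gaussBinom_X_mul_f_one_sub_one_dvd {k l m : ℕ} (hk : m ≤ k) (hl : m ≤ l) :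
    (X : PowerSeries ℤ) ^ (m + 1) ∣ gaussBinom X k l * f 1 - 1 := by
  rw [← isUnit_f_one.dvd_mul_left]
  have h := gaussBinom_mul_qFactorial_mul_qFactorial (X : PowerSeries ℤ) k l
  have e : f 1 * (gaussBinom X k l * f 1 - 1) =
      gaussBinom X k l * f 1 * (f 1 - qFactorial X k) +
        gaussBinom X k l * qFactorial X k * (f 1 - qFactorial X l) -
          (f 1 - qFactorial X (k + l)) := by
    linear_combination h
  rw [e]
  exact dvd_sub (dvd_add ((f_one_sub_qFactorial_dvd hk).mul_left _)
    ((f_one_sub_qFactorial_dvd hl).mul_left _)) (f_one_sub_qFactorial_dvd (by lia))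

/-- **Jacobi's identity** for the cube of the Euler product, modulo `q ^ (n + 1)`. -/
theorem f_one_pow_three_sub_sum_dvd (n : ℕ) :
    (X : PowerSeries ℤ) ^ (n + 1) ∣ f 1 ^ 3 -
      ∑ j ∈ Finset.range (n + 1),
        (-1) ^ j * (2 * (j : PowerSeries ℤ) + 1) * X ^ (j + 1).choose 2 := by
  have h := mul_left_cancel₀ (pow_ne_zero _ X_ne_zero)
    (pow_mul_qFactorial_sq_eq_sum_range (X : PowerSeries ℤ) n)
  have e : f 1 ^ 3 -
      ∑ j ∈ Finset.range (n + 1), (-1) ^ j * (2 * (j : PowerSeries ℤ) + 1) * X ^ (j + 1).choose 2 =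
      f 1 * (f 1 + qFactorial X n) * (f 1 - qFactorial X n) +
        ∑ j ∈ Finset.range (n + 1), (-1) ^ j * (2 * (j : PowerSeries ℤ) + 1) *
          (X ^ (j + 1).choose 2 * (gaussBinom X (n + 1 + j) (n - j) * f 1 - 1)) := by
    have e₁ : f 1 ^ 3 = f 1 * (f 1 + qFactorial X n) * (f 1 - qFactorial X n) +
        qFactorial X n ^ 2 * f 1 := by ring
    rw [e₁, h, add_sub_assoc, Finset.sum_mul, ← Finset.sum_sub_distrib]
    congr 1
    refine Finset.sum_congr rfl fun j _ => ?_
    rw [gaussBinom_X_comm (n - j)]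
    ring
  rw [e]
  refine dvd_add ((f_one_sub_qFactorial_dvd le_rfl).mul_left _) (Finset.dvd_sum fun j hj => ?_)
  refine Dvd.dvd.mul_left ?_ _
  rw [Finset.mem_range] at hj
  have hdvd := mul_dvd_mul (dvd_refl ((X : PowerSeries ℤ) ^ (j + 1).choose 2))
    (gaussBinom_X_mul_f_one_sub_one_dvd (k := n + 1 + j) (l := n - j) (m := n - j)
      (by lia) le_rfl)
  rw [← pow_add] at hdvd
  refine (pow_dvd_pow _ ?_).trans hdvd
  -- The precision `n - j + 1` suffices because `(j + 1).choose 2 ≥ j`.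
  rw [Nat.choose_succ_succ' j 1, Nat.choose_one_right]
  lia

theorem coeff_f_one_pow_three (n : ℕ) :
    coeff n (f 1 ^ 3) = ∑ j ∈ Finset.range (n + 1),
      if n = (j + 1).choose 2 then (-1) ^ j * (2 * j + 1 : ℤ) else 0 := by
  have h := X_pow_dvd_iff.1 (f_one_pow_three_sub_sum_dvd n) n n.lt_succ_self
  rw [map_sub, sub_eq_zero, map_sum] at h
  rw [h]
  refine Finset.sum_congr rfl fun j _ => ?_
  rw [show ((-1) ^ j * (2 * j + 1) : PowerSeries ℤ) = C ((-1) ^ j * (2 * j + 1 : ℤ)) by simp,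
    coeff_C_mul, coeff_X_pow, mul_ite, mul_one, mul_zero]

theorem coeff_f_one_pow_three_choose (j : ℕ) :
    coeff ((j + 1).choose 2) (f 1 ^ 3) = (-1) ^ j * (2 * j + 1 : ℤ) := by
  rw [coeff_f_one_pow_three, Finset.sum_eq_single j]
  · simp
  · intro i _ hij
    have hmono : StrictMono fun j : ℕ => (j + 1).choose 2 :=
      strictMono_nat_of_lt_succ fun j => by
        rw [Nat.choose_succ_succ' (j + 1) 1, Nat.choose_one_right]
        lia
    exact if_neg fun h => hij (hmono.injective h.symm)
  · intro h
    rw [Nat.choose_succ_succ' j 1, Nat.choose_one_right, Finset.mem_range] at h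
    lia

theorem coeff_f_one_pow_three_eq_zero {n : ℕ} (h : ∀ j : ℕ, (j + 1).choose 2 ≠ n) :
    coeff n (f 1 ^ 3) = 0 := by
  rw [coeff_f_one_pow_three]
  exact Finset.sum_eq_zero fun j _ => if_neg fun hj => h j hj.symm

/-! ### 5-dissections and the Hecke relation -/

theorem coeff_mul_eq_zero_of_forall_add_eq {R : Type*} [Semiring R] {g h : PowerSeries R} {n : ℕ}
    (H : ∀ i j, i + j = n → coeff i g = 0 ∨ coeff j h = 0) : coeff n (g * h) = 0 := by
  rw [coeff_mul]
  refine Finset.sum_eq_zero fun p hp => ?_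
  rcases H p.1 p.2 (Finset.HasAntidiagonal.mem_antidiagonal.1 hp) with h | h <;> simp [h]

/-- The terms of `f 1` with exponent `≡ 1 (mod 5)` make up `-q * f 25`. -/
theorem coeff_f_one_add_X_mul_expand {n : ℕ} (h₀ : n % 5 ≠ 0) (h₂ : n % 5 ≠ 2) :
    coeff n (f 1 + X ^ 1 * expand 25 (by norm_num) (f 1)) = 0 := by
  rw [map_add, coeff_X_pow_mul', coeff_expand, f_one_eq_pentagonalSeries]
  by_cases hn : n ∈ Set.range pentagonal
  · obtain ⟨k, rfl⟩ := hn
    have hk := two_mul_natCast_pentagonal k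
    -- For `k ≡ 0, 1, 2, 3, 4` modulo 5, `pentagonal k ≡ 0, 1, 0, 2, 2`.
    obtain ⟨j, hj⟩ : ∃ j : ℤ, k = 5 * j + 1 := by
      obtain ⟨j, hj⟩ : ∃ j, j = k / 5 := ⟨_, rfl⟩
      have hk5 : k = 5 * j ∨ k = 5 * j + 1 ∨ k = 5 * j + 2 ∨ k = 5 * j + 3 ∨ k = 5 * j + 4 := by
        lia
      rcases hk5 with rfl | h | rfl | rfl | rfl
      all_goals first
        | exact ⟨j, h⟩
        | exfalso; ring_nf at hk; lia
    have hp : pentagonal k = 25 * pentagonal (-j) + 1 := by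
      have := two_mul_natCast_pentagonal_neg j
      subst hj
      zify
      linarith
    rw [coeff_pentagonalSeries_pentagonal, hp, if_pos (by lia), if_pos (by simp),
      Nat.add_sub_cancel, Nat.mul_div_cancel_left _ (by norm_num),
      coeff_pentagonalSeries_pentagonal, hj]
    have hsign : Int.negOnePow (5 * j + 1) = -Int.negOnePow (-j) := by
      rw [Int.negOnePow_succ, neg_inj, Int.negOnePow_eq_iff]
      exact ⟨3 * j, by ring⟩
    simp [hsign]
  · rw [coeff_pentagonalSeries_eq_zero ℤ hn, zero_add]
    split_ifs with h1 h25
    · obtain ⟨m, hm⟩ := h25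
      rw [hm, Nat.mul_div_cancel_left _ (by norm_num)]
      refine coeff_pentagonalSeries_eq_zero ℤ ?_
      rintro ⟨j, rfl⟩
      refine hn ⟨5 * -j + 1, ?_⟩
      have e₁ := two_mul_natCast_pentagonal j
      have e₂ := two_mul_natCast_pentagonal (5 * -j + 1)
      zify [h1] at hm ⊢
      linarith
    · rfl
    · rfl

/-- The terms of `f 1 ^ 3` with exponent `≡ 3 (mod 5)` make up `5 q ^ 3 * f 25 ^ 3`. -/
theorem coeff_f_one_pow_three_sub_X_pow_mul_expand {n : ℕ} (h₀ : n % 5 ≠ 0) (h₁ : n % 5 ≠ 1) :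
    coeff n (f 1 ^ 3 - 5 * (X ^ 3 * expand 25 (by norm_num) (f 1 ^ 3))) = 0 := by
  rw [show (5 : PowerSeries ℤ) = C 5 by simp, map_sub, coeff_C_mul, coeff_X_pow_mul',
    coeff_expand]
  have hchoose (k : ℕ) : 2 * (k + 1).choose 2 = (k + 1) * k := by
    rw [Nat.choose_two_right, Nat.mul_div_cancel' (Nat.even_mul_pred_self _).two_dvd]
    simp
  by_cases hn : ∃ j : ℕ, (j + 1).choose 2 = n
  · obtain ⟨k, rfl⟩ := hn
    have hk := hchoose k
    -- For `k ≡ 0, 1, 2, 3, 4` modulo 5, the triangular number is `≡ 0, 1, 3, 1, 0`. At `k = 5 * j +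
    -- 2` the coefficient `2 * k + 1 = 5 * (2 * j + 1)` supplies the factor 5.
    obtain ⟨j, hj⟩ : ∃ j : ℕ, k = 5 * j + 2 := by
      obtain ⟨j, hj⟩ : ∃ j, j = k / 5 := ⟨_, rfl⟩
      have hk5 : k = 5 * j ∨ k = 5 * j + 1 ∨ k = 5 * j + 2 ∨ k = 5 * j + 3 ∨ k = 5 * j + 4 := by
        lia
      rcases hk5 with rfl | rfl | h | rfl | rfl
      all_goals first
        | exact ⟨j, h⟩
        | exfalso; ring_nf at hk h₀ h₁; lia
    have hp : (k + 1).choose 2 = 25 * (j + 1).choose 2 + 3 := by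
      have := hchoose j
      subst hj
      linarith
    rw [coeff_f_one_pow_three_choose, hp, if_pos (by lia), if_pos (by simp),
      Nat.add_sub_cancel, Nat.mul_div_cancel_left _ (by norm_num),
      coeff_f_one_pow_three_choose, hj]
    push_cast
    rw [pow_add, pow_mul]
    norm_num
    ring
  · push Not at hn
    rw [coeff_f_one_pow_three_eq_zero hn, zero_sub, neg_eq_zero]
    split_ifs with h1 h25
    · obtain ⟨m, hm⟩ := h25
      rw [hm, Nat.mul_div_cancel_left _ (by norm_num), coeff_f_one_pow_three_eq_zero, mul_zero]
      rintro j rfl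
      refine hn (5 * j + 2) ?_
      have e₁ := hchoose j
      have e₂ := hchoose (5 * j + 2)
      zify [h1] at hm e₁ e₂ ⊢
      linarith
    · simp
    · simp

theorem coeff_X_pow_mul_expand_eq_zero {R : Type*} [CommRing R] {p : ℕ} (hp : p ≠ 0) {d n : ℕ}
    (h : ¬ n ≡ d [MOD p]) (g : PowerSeries R) : coeff n (X ^ d * expand p hp g) = 0 := by
  rw [coeff_X_pow_mul']
  split_ifs with hd
  · exact coeff_expand_of_not_dvd p hp _ fun hdvd => h ((Nat.modEq_iff_dvd' hd).2 hdvd).symm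
  · rfl

/-- Only `-5 q ^ 4 * f 25 ^ 4` contributes to the terms of `f 1 ^ 4` with exponent
`≡ 4 (mod 5)`. -/
theorem coeff_f_one_pow_four_add_X_pow_mul_expand {n : ℕ} (hn : n % 5 = 4) :
    coeff n (f 1 ^ 4 + 5 * (X ^ 4 * expand 25 (by norm_num) (f 1 ^ 4))) = 0 := by
  set A := f 1 + X ^ 1 * expand 25 (by norm_num) (f 1) with hA
  set J := f 1 ^ 3 - 5 * (X ^ 3 * expand 25 (by norm_num) (f 1 ^ 3)) with hJ
  -- `A` lives on residues 0, 2 and `J` on 0, 1, so the three products live on {0, 1, 2, 3}, {0, 3}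
  -- and {1, 2}: none reaches 4.
  have e : f 1 ^ 4 + 5 * (X ^ 4 * expand 25 (by norm_num) (f 1 ^ 4)) =
      A * J + C 5 * (A * (X ^ 3 * expand 25 (by norm_num) (f 1 ^ 3))) -
        (X ^ 1 * expand 25 (by norm_num) (f 1)) * J := by
    rw [hA, hJ, map_pow, map_pow, show (C 5 : PowerSeries ℤ) = 5 by simp]
    ring
  have hE {d m : ℕ} (h : m % 5 ≠ d % 5) (g : PowerSeries ℤ) :
      coeff m (X ^ d * expand 25 (by norm_num) g) = 0 :=
    coeff_X_pow_mul_expand_eq_zero _ (fun h' => h (h'.of_dvd (by norm_num))) g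
  rw [e, map_sub, map_add, coeff_C_mul, coeff_mul_eq_zero_of_forall_add_eq,
    coeff_mul_eq_zero_of_forall_add_eq, coeff_mul_eq_zero_of_forall_add_eq]
  · simp
  · intro i j hij
    by_cases hi : i % 5 = 1
    · exact .inr (coeff_f_one_pow_three_sub_X_pow_mul_expand (by lia) (by lia))
    · exact .inl (hE (by lia) _)
  · intro i j hij
    by_cases hj : j % 5 = 3
    · exact .inl (coeff_f_one_add_X_mul_expand (by lia) (by lia))
    · exact .inr (hE (by lia) _)
  · intro i j hij
    by_cases hi : i % 5 = 0 ∨ i % 5 = 2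
    · exact .inr (coeff_f_one_pow_three_sub_X_pow_mul_expand (by lia) (by lia))
    · exact .inl (coeff_f_one_add_X_mul_expand (by lia) (by lia))

/-- The Hecke relation at `5`. -/
theorem PStar_five_mul_add_four (n : ℕ) : PStar (5 * n + 4) = -5 * PStar n := by
  have h5 : f 5 = expand 5 (by norm_num) (f 1) := f_eq_expand _
  -- Multiplying by `f 5 ^ 4`, a series in `q ^ 5`, preserves residue classes, and `f 25 ^ 4 * f 5 ^
  -- 4` is the original product at `q ^ 5`.
  have e : f 1 ^ 4 * f 5 ^ 4 =
      (f 1 ^ 4 + 5 * (X ^ 4 * expand 25 (by norm_num) (f 1 ^ 4))) *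
          expand 5 (by norm_num) (f 1 ^ 4) -
        C 5 * (X ^ 4 * expand 5 (by norm_num) (f 1 ^ 4 * f 5 ^ 4)) := by
    rw [show expand 25 _ (f 1 ^ 4) = expand 5 (by norm_num) (f 5 ^ 4) by
      rw [h5, ← map_pow, ← expand_mul], map_mul, map_pow _ (f 1), h5,
      show (C 5 : PowerSeries ℤ) = 5 by simp]
    ring
  rw [PStar, e, map_sub, coeff_mul_eq_zero_of_forall_add_eq, coeff_C_mul,
    coeff_X_pow_mul, coeff_expand_mul, PStar]
  · ring
  · intro i j hij
    by_cases hj : 5 ∣ j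
    · exact .inl (coeff_f_one_pow_four_add_X_pow_mul_expand (by lia))
    · exact .inr (coeff_expand_of_not_dvd _ _ _ hj)

/-- With the index shifted by one, `5 * n + 4` becomes multiplication by 5; `hm` keeps the
subtraction from truncating. -/
theorem PStar_five_pow_mul_sub_one (α : ℕ) {m : ℕ} (hm : 0 < m) :
    PStar (5 ^ α * m - 1) = (-5) ^ α * PStar (m - 1) := by
  induction α with
  | zero => simp
  | succ α ih =>
    have hpos : 0 < 5 ^ α * m := by positivity
    rw [show 5 ^ (α + 1) * m - 1 = 5 * (5 ^ α * m - 1) + 4 by rw [pow_succ']; lia,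
      PStar_five_mul_add_four, ih]
    ring

/-! ### Divisibility by 4 at odd indices -/

theorem two_dvd_pow_two_sub_expand (g : PowerSeries ℤ) :
    (2 : PowerSeries ℤ) ∣ g ^ 2 - expand 2 (by norm_num) g := by
  suffices h : ∀ n, (2 : ℤ) ∣ coeff n (g ^ 2 - expand 2 (by norm_num) g) by
    choose c hc using h
    refine ⟨PowerSeries.mk c, ?_⟩
    ext n
    rw [hc, show (2 : PowerSeries ℤ) = C 2 by simp, coeff_C_mul, coeff_mk]
  intro n
  -- Squaring is the Frobenius map modulo 2, which fixes coefficients in `ZMod 2`.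
  have h : map (Int.castRingHom (ZMod 2)) (expand 2 two_ne_zero g) =
      map (Int.castRingHom (ZMod 2)) g ^ 2 := by
    have h' : map (frobenius (ZMod 2) 2)
        (expand 2 two_ne_zero (map (Int.castRingHom (ZMod 2)) g)) =
        map (Int.castRingHom (ZMod 2)) g ^ 2 :=
      MvPowerSeries.map_frobenius_expand 2 two_ne_zero
    rwa [ZMod.frobenius_zmod, map_id, id_eq, ← map_expand] at h'
  have h' := congrArg (coeff n) h
  rw [← map_pow, coeff_map, coeff_map, eq_comm, ← sub_eq_zero, ← map_sub, ← map_sub] at h'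
  exact (ZMod.intCast_zmod_eq_zero_iff_dvd _ 2).1 h'

theorem four_dvd_pow_four_sub_expand (g : PowerSeries ℤ) :
    (4 : PowerSeries ℤ) ∣ g ^ 4 - expand 2 (by norm_num) (g ^ 2) := by
  obtain ⟨c, hc⟩ := two_dvd_pow_two_sub_expand g
  -- Squaring `g ^ 2 = E + 2 * c` gives `g ^ 4 = E ^ 2 + 4 * c * (E + c)`, where `E` is the
  -- expansion of `g`.
  refine ⟨c * (expand 2 (by norm_num) g + c), ?_⟩
  rw [map_pow]
  linear_combination (g ^ 2 + expand 2 (by norm_num) g + 2 * c) * hc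

theorem four_dvd_PStar_of_odd {n : ℕ} (hn : Odd n) : 4 ∣ PStar n := by
  obtain ⟨c, hc⟩ := four_dvd_pow_four_sub_expand (f 1 * f 5)
  rw [mul_pow, sub_eq_iff_eq_add, show (4 : PowerSeries ℤ) = C 4 by simp] at hc
  rw [PStar, hc, map_add, coeff_C_mul, coeff_expand_of_not_dvd _ _ _ (by grind), add_zero]
  exact dvd_mul_right _ _

end RestrictedPartitions

theorem theorem1p5 (n α : ℕ) (hα : 1 ≤ α) :
    RestrictedPartitions.PStar (2 * 5 ^ α * n + 2 * 5 ^ α - 1) ≡ 0 [ZMOD 2 ^ 2 * 5 ^ α] := by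
  rw [Int.modEq_zero_iff_dvd]
  have hpos : 0 < 5 ^ α * (n + 1) := by positivity
  have e : 2 * 5 ^ α * n + 2 * 5 ^ α - 1 = 5 ^ α * (2 * (n + 1)) - 1 := by
    congr 1
    ring
  rw [e]
  refine IsCoprime.mul_dvd ?_ ?_ ?_
  · exact IsCoprime.pow (by norm_num)
  · exact RestrictedPartitions.four_dvd_PStar_of_odd ⟨5 ^ α * (n + 1) - 1, by lia⟩
  · rw [RestrictedPartitions.PStar_five_pow_mul_sub_one α (by positivity), neg_pow]
    exact ((dvd_refl _).mul_left _).mul_right _
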